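/- The model is the deterministic cell-probe model with cells of $w$ bits: each operation (update or query) is an adaptive program that starts with no knowledge of the memory and reads or writes cells. Its running time is the number of probes, computation is free, the initial memory may be arbitrary, and space is unrestricted. In the dynamic marked ancestor problem on the complete tree of degree $b$ and depth $d$, an update changes the mark of one vertex, and a query, given a leaf $v$, asks whether some vertex on the path from the root to $v$ (both ends included) is marked. In the incremental version all vertices start unmarked and the updates mark vertices; in the decremental version all vertices start marked and the updates unmark vertices. In both versions no vertex is updated twice. Write $\lg = \log_2$. Theorem. For every integer $c \ge 0$ there are $C > 0$ and $m_0$, depending only on $c$, such that the following holds for each of the two versions and every $m \ge m_0$. There is a complete tree of some degree $b \ge 2$ and some depth $d$, with at most $m$ vertices (so that there are at most $m$ updates), such that every data structure for that version of dynamic marked ancestor on this tree, with cells of $w \le (\lg m)^c$ bits and worst-case update time $t_u \le (\lg m)^c$, has worst-case query time $$ t_q \;\ge\; C \cdot \frac{\lg m}{(\lg\lg m)^2}. $$ In other words, dynamic marked ancestor (incremental or decremental) with update time $\operatorname{polylog} m$ needs query time $\Omega(\lg m/\lg^2\lg m)$. -/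

import Mathlib

namespace CellProbe

/-- The memory of a cell-probe machine: cells of `w` bits each, addressed by natural numbers. No bound
on the number of cells in use is imposed. -/
abbrev Memory (w : ℕ) : Type := ℕ → BitVec w

/-- A deterministic cell-probe program. The next probe depends on the program and on the contents of
all cells read so far; computation between probes is free. -/
inductive Program (w : ℕ) (α : Type) : Type
  | ret (a : α) : Program w α
  | read (addr : ℕ) (next : BitVec w → Program w α) : Program w α
  | write (addr : ℕ) (value : BitVec w) (next : Program w α) : Program w α

namespace Program

variable {w : ℕ} {α : Type}

/-- The value returned by a program started on the memory `M`. -/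
def output : Program w α → Memory w → α
  | ret a, _ => a
  | read addr next, M => (next (M addr)).output M
  | write addr value next, M => next.output (Function.update M addr value)

/-- The memory left behind by a program started on the memory `M`. -/
def finalMemory : Program w α → Memory w → Memory w
  | ret _, M => M
  | read addr next, M => (next (M addr)).finalMemory M
  | write addr value next, M => next.finalMemory (Function.update M addr value)

/-- The running time on the memory `M`: the number of probes (reads and writes). -/
def time : Program w α → Memory w → ℕ
  | ret _, _ => 0
  | read addr next, M => (next (M addr)).time M + 1
  | write addr value next, M => next.time (Function.update M addr value) + 1

end Program

/-- The vertices of the complete tree of degree `b` and depth `d`: a vertex at depth `i ≤ d` is the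
sequence of the `i` branching choices made on the way from the root to it. -/
abbrev Vertex (b d : ℕ) : Type := Σ i : Fin (d + 1), (Fin (i : ℕ) → Fin b)

/-- The leaves of the complete tree of degree `b` and depth `d`. -/
abbrev Leaf (b d : ℕ) : Type := Fin d → Fin b

/-- The vertex at depth `i` on the path from the root to the leaf `v`
(the root for `i = 0`, the leaf itself for `i = d`). -/
def pathVertex {b d : ℕ} (v : Leaf b d) (i : Fin (d + 1)) : Vertex b d :=
  ⟨i, fun j => v (Fin.castLE (Nat.le_of_lt_succ i.isLt) j)⟩

/-- The two one-sided versions of the dynamic marked ancestor problem. -/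
inductive Variant : Type
  /-- All vertices start unmarked, and an update marks a vertex. -/
  | incremental
  /-- All vertices start marked, and an update unmarks a vertex. -/
  | decremental

/-- The set of marked vertices after the updates in the list `σ` have been performed. -/
def Variant.marked {b d : ℕ} : Variant → List (Vertex b d) → Set (Vertex b d)
  | incremental, σ => {x | x ∈ σ}
  | decremental, σ => {x | x ∉ σ}

/-- A dynamic data structure for marked ancestor, with `w`-bit cells: an initial memory, a program for
the update of each vertex, and a program for the query at each leaf. Programs keep no state between
operations other than the memory. -/
structure DataStructure (w b d : ℕ) where
  init : Memory w
  update : Vertex b d → Program w Unit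
  query : Leaf b d → Program w Bool

namespace DataStructure

variable {w b d : ℕ}

/-- The memory after the updates in the list `σ`, performed in order from the initial memory. -/
def memoryAfter (D : DataStructure w b d) (σ : List (Vertex b d)) : Memory w :=
  σ.foldl (fun M x => (D.update x).finalMemory M) D.init

/-- `D` solves the given variant of dynamic marked ancestor with worst-case update time `tu` and
worst-case query time `tq`. No vertex is updated twice. -/
structure Solves (D : DataStructure w b d) (V : Variant) (tu tq : ℕ) : Prop where
  update_time : ∀ (σ : List (Vertex b d)) (x : Vertex b d), (σ ++ [x]).Nodup →
    (D.update x).time (D.memoryAfter σ) ≤ tu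
  query_time : ∀ (σ : List (Vertex b d)) (v : Leaf b d), σ.Nodup →
    (D.query v).time (D.memoryAfter σ) ≤ tq
  query_correct : ∀ (σ : List (Vertex b d)) (v : Leaf b d), σ.Nodup →
    ((D.query v).output (D.memoryAfter σ) = true ↔
      ∃ i : Fin (d + 1), pathVertex v i ∈ V.marked σ)

end DataStructure

end CellProbe

namespace CellProbe

/-! Let b = 2h and n = b^d. A table `T` of bits fixes a marking for each of n versions: if version t
has the digits u, a vertex at depth i + 1 is unmarked exactly when the bit of its last branching
choice is the one prescribed by u, its path and one entry of `T`. Epochs run from the deepest level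
up, and epoch i depends only on t / b^i. Hence few cells change between versions: the contents of
all cells within reach of a query, over all versions, split into S ≈ 2 d b^(d+1) tu constant pieces
(`card_breaks_le`, `exists_pieces`).

Given one permutation of the h labels per group, the versions can be routed bijectively, as in a
butterfly network, along unmarked paths (`walk_surjective`). The n queries at the ends of these
paths read at most n·tq pieces. Those pieces certify N = d b^(d-1) h entries of `T`, namely the
graphs of the permutations (`matches_walk_iff`).

In `exists_card_bounds`, pigeonholes fix a set of at most n·tq pieces and their descriptions. The
remaining inputs agree on the union U of the certified graphs, so |U| is at most the number of bits
for the set and the descriptions. The remaining permutation families have all graphs inside U, so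
there are at most (|U|/N)^N of them. If tq·lg(O(b·tu)) ≤ d, the set costs O(1) bits per certified
entry and |U| = O(βN), with β bits per piece; against the (h!)^(N/h) families this forces h = O(β)
(`degree_le`). Taking h a larger power of lg m than β gives tq = Ω(d / lg lg m) with d = Θ(lg m / lg
lg m). -/

lemma card_bitVec (w : ℕ) : Fintype.card (BitVec w) = 2 ^ w := by
  rw [Fintype.card_congr BitVec.equivFin.toEquiv, Fintype.card_fin]

/-! ### Addresses probed by programs and by sequences of updates -/

namespace Program

variable {w : ℕ} {α : Type}

/-- The addresses probed by a program started on the memory `M`. -/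
def probed : Program w α → Memory w → Finset ℕ
  | ret _, _ => ∅
  | read addr next, M => insert addr ((next (M addr)).probed M)
  | write addr value next, M => insert addr (next.probed (Function.update M addr value))

/-- The addresses which a program may probe within its first `t` steps, on any memory. -/
def reach : ℕ → Program w α → Finset ℕ
  | 0, _ => ∅
  | _ + 1, ret _ => ∅
  | t + 1, read addr next => insert addr (Finset.univ.biUnion fun x => reach t (next x))
  | t + 1, write addr _ next => insert addr (reach t next)

lemma card_probed_le (p : Program w α) (M : Memory w) : (p.probed M).card ≤ p.time M := by
  induction p generalizing M with
  | ret a => simp [probed]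
  | read addr next ih =>
    exact (Finset.card_insert_le _ _).trans (Nat.succ_le_succ (ih _ _))
  | write addr value next ih =>
    exact (Finset.card_insert_le _ _).trans (Nat.succ_le_succ (ih _))

lemma output_congr (p : Program w α) {M M' : Memory w} (h : ∀ a ∈ p.probed M, M' a = M a) :
    p.output M' = p.output M := by
  induction p generalizing M M' with
  | ret a => rfl
  | read addr next ih =>
    simp only [probed, Finset.mem_insert, forall_eq_or_imp] at h
    simp only [output, h.1]
    exact ih _ h.2
  | write addr value next ih =>
    simp only [probed, Finset.mem_insert, forall_eq_or_imp] at h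
    simp only [output]
    refine ih fun a ha => ?_
    by_cases hx : a = addr
    · simp [hx]
    · simp [hx, h.2 a ha]

lemma finalMemory_of_notMem (p : Program w α) {M : Memory w} {a : ℕ} (h : a ∉ p.probed M) :
    p.finalMemory M a = M a := by
  induction p generalizing M with
  | ret _ => rfl
  | read addr next ih =>
    simp only [probed, Finset.mem_insert, not_or] at h
    exact ih _ h.2
  | write addr value next ih =>
    simp only [probed, Finset.mem_insert, not_or] at h
    simp only [finalMemory]
    rw [ih h.2, Function.update_of_ne h.1]

lemma probed_subset_reach (p : Program w α) {M : Memory w} {t : ℕ} (h : p.time M ≤ t) :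
    p.probed M ⊆ p.reach t := by
  induction p generalizing M t with
  | ret _ => simp [probed]
  | read addr next ih =>
    obtain _ | t := t
    · simp [time] at h
    · refine Finset.insert_subset_insert _ ((ih _ (Nat.le_of_succ_le_succ h)).trans ?_)
      exact Finset.subset_biUnion_of_mem (fun x => reach t (next x)) (Finset.mem_univ _)
  | write addr value next ih =>
    obtain _ | t := t
    · simp [time] at h
    · exact Finset.insert_subset_insert _ (ih (Nat.le_of_succ_le_succ h))

/-- The program is a decision tree with 2^w branches at each read. This bound replaces one on space:
only these addresses have to be numbered in descriptions of pieces. -/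
lemma card_reach_le (p : Program w α) (t : ℕ) : (p.reach t).card ≤ (2 ^ w + 1) ^ t := by
  induction t generalizing p with
  | zero => simp [reach]
  | succ t ih =>
    have h1 : 1 ≤ (2 ^ w + 1) ^ t := Nat.one_le_pow _ _ (by positivity)
    cases p with
    | ret _ => simp [reach]
    | read addr next =>
      refine (Finset.card_insert_le _ _).trans ?_
      have := Finset.card_biUnion_le_card_mul (Finset.univ : Finset (BitVec w))
        (fun x => reach t (next x)) _ fun x _ => ih (next x)
      rw [Finset.card_univ, card_bitVec] at this
      rw [pow_succ]
      nlinarith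
    | write addr value next =>
      refine (Finset.card_insert_le _ _).trans ?_
      have := ih next
      have h2 : 1 ≤ 2 ^ w := Nat.one_le_two_pow
      rw [pow_succ]
      nlinarith

end Program

namespace DataStructure

variable {w b d : ℕ}

/-- The memory after the updates in the list `σ`, performed in order from the memory `M`. -/
def run (D : DataStructure w b d) (M : Memory w) (σ : List (Vertex b d)) : Memory w :=
  σ.foldl (fun M x => (D.update x).finalMemory M) M

/-- The addresses probed by the updates in the list `σ`, performed in order from `M`. -/
def touched (D : DataStructure w b d) : Memory w → List (Vertex b d) → Finset ℕ
  | _, [] => ∅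
  | M, x :: σ => (D.update x).probed M ∪ D.touched ((D.update x).finalMemory M) σ

lemma run_append (D : DataStructure w b d) (M : Memory w) (σ σ' : List (Vertex b d)) :
    D.run M (σ ++ σ') = D.run (D.run M σ) σ' := by
  simp [run]

lemma memoryAfter_append (D : DataStructure w b d) (σ σ' : List (Vertex b d)) :
    D.memoryAfter (σ ++ σ') = D.run (D.memoryAfter σ) σ' := by
  simp [memoryAfter, run]

lemma run_of_notMem (D : DataStructure w b d) {M : Memory w} {σ : List (Vertex b d)} {a : ℕ}
    (h : a ∉ D.touched M σ) : D.run M σ a = M a := by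
  induction σ generalizing M with
  | nil => rfl
  | cons x σ ih =>
    simp only [touched, Finset.mem_union, not_or] at h
    exact (ih h.2).trans (Program.finalMemory_of_notMem _ h.1)

lemma Solves.card_touched_le {D : DataStructure w b d} {V : Variant} {tu tq : ℕ}
    (hD : D.Solves V tu tq) (σ₀ σ : List (Vertex b d)) (h : (σ₀ ++ σ).Nodup) :
    (D.touched (D.memoryAfter σ₀) σ).card ≤ σ.length * tu := by
  induction σ generalizing σ₀ with
  | nil => simp [touched]
  | cons x σ ih =>
    have h' : ((σ₀ ++ [x]) ++ σ).Nodup := by simpa using h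
    have h1 := ih _ h'
    rw [memoryAfter_append] at h1
    have h2 := ((D.update x).card_probed_le _).trans
      (hD.update_time σ₀ x (h'.sublist (List.sublist_append_left _ _)))
    refine (Finset.card_union_le _ _).trans ?_
    rw [List.length_cons, Nat.succ_mul, add_comm]
    exact add_le_add h1 h2

end DataStructure

/-! ### Piecewise constant sequences and counting inequalities -/

open Classical in
/-- A sequence of `K` values with at most `S` breaks consists of at most `S + 1` constant pieces. -/
lemma exists_pieces {V : Type} (K S : ℕ) (f : ℕ → V)
    (h : ((Finset.range K).filter fun k => k + 1 < K ∧ f (k + 1) ≠ f k).card ≤ S) :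
    ∃ (piece : ℕ → Fin (S + 1)) (desc : Fin (S + 1) → Option (Fin K × Fin K × V)),
      (∀ k < K, ∃ lo hi : Fin K, desc (piece k) = some (lo, hi, f k) ∧ lo ≤ k ∧ k ≤ hi) ∧
      ∀ p lo hi v, desc p = some (lo, hi, v) → ∀ k, (lo : ℕ) ≤ k → k ≤ hi → f k = v := by
  set B := (Finset.range K).filter fun k => k + 1 < K ∧ f (k + 1) ≠ f k with hB
  -- The number of breaks before k serves as the index of its piece.
  let rk : ℕ → ℕ := fun k => (B.filter (· < k)).card
  have rk_mono : Monotone rk := fun k k' hk => Finset.card_le_card fun j hj => by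
    simp only [Finset.mem_filter] at hj ⊢
    exact ⟨hj.1, hj.2.trans_le hk⟩
  have rk_lt : ∀ k, rk k < S + 1 := fun k =>
    Nat.lt_succ_of_le ((Finset.card_le_card (Finset.filter_subset _ _)).trans h)
  have key : ∀ k j, j + k < K → rk (j + k) = rk j → f (j + k) = f j := by
    intro k
    induction k with
    | zero => intros; rfl
    | succ k ih =>
      intro j hj hr
      have h1 : rk (j + k) = rk j :=
        le_antisymm ((rk_mono (by omega)).trans hr.le) (rk_mono (by omega))
      rw [← ih j (by omega) h1]
      by_contra hne
      have hmem : j + k ∈ B := by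
        rw [hB, Finset.mem_filter, Finset.mem_range]
        exact ⟨by omega, by omega, hne⟩
      have : rk (j + k) < rk (j + (k + 1)) := by
        refine Finset.card_lt_card ⟨fun i hi => ?_, fun hs => ?_⟩
        · simp only [Finset.mem_filter] at hi ⊢
          exact ⟨hi.1, by omega⟩
        · have := hs (Finset.mem_filter.2 ⟨hmem, by omega⟩)
          simp at this
      omega
  have key' : ∀ j k, j ≤ k → k < K → rk k = rk j → f k = f j := fun j k hjk hk hr => by
    have := key (k - j) j (by omega) (by rwa [Nat.add_sub_cancel' hjk])
    rwa [Nat.add_sub_cancel' hjk] at this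
  have hex : ∀ p : Fin (S + 1), (∃ k < K, rk k = p) → ∃ lo hi : Fin K,
      rk lo = p ∧ rk hi = p ∧ ∀ k < K, rk k = p → (lo : ℕ) ≤ k ∧ k ≤ hi := by
    rintro p ⟨k, hk, hp⟩
    have hne : ((Finset.univ : Finset (Fin K)).filter fun k : Fin K => rk (k : ℕ) = p).Nonempty :=
      ⟨⟨k, hk⟩, by simpa using hp⟩
    refine ⟨Finset.min' _ hne, Finset.max' _ hne,
      (Finset.mem_filter.1 (Finset.min'_mem _ hne)).2,
      (Finset.mem_filter.1 (Finset.max'_mem _ hne)).2, fun k' hk' hp' => ?_⟩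
    have hm : (⟨k', hk'⟩ : Fin K) ∈
        (Finset.univ : Finset (Fin K)).filter fun k : Fin K => rk (k : ℕ) = p := by
      simpa using hp'
    exact ⟨Fin.le_def.1 (Finset.min'_le _ _ hm), Fin.le_def.1 (Finset.le_max' _ _ hm)⟩
  choose lo hi h1 h2 h3 using hex
  refine ⟨fun k => ⟨rk k, rk_lt k⟩, fun p =>
    if hp : ∃ k < K, rk k = p then some (lo p hp, hi p hp, f (lo p hp)) else none, ?_, ?_⟩
  · intro k hk
    have hp : ∃ k' < K, rk k' = ((⟨rk k, rk_lt k⟩ : Fin (S + 1)) : ℕ) := ⟨k, hk, rfl⟩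
    have h4 := h3 _ hp k hk rfl
    refine ⟨lo _ hp, hi _ hp, ?_, h4.1, h4.2⟩
    dsimp only
    rw [dif_pos hp, key' _ k h4.1 hk (h1 _ hp).symm]
  · intro p l u v hd k hlk hku
    by_cases hp : ∃ k < K, rk k = p
    swap
    · simp only [dif_neg hp, reduceCtorEq] at hd
    simp only [dif_pos hp, Option.some.injEq, Prod.mk.injEq] at hd
    obtain ⟨rfl, rfl, rfl⟩ := hd
    refine key' _ k hlk (hku.trans_lt (hi p hp).2) (le_antisymm ?_ ?_)
    · rw [h1 p hp, ← h2 p hp]; exact rk_mono hku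
    · exact rk_mono hlk

/-- The number of subsets of an `S`-element set with at most `q` elements. -/
def smallSubsets (S q : ℕ) : ℕ :=
  ((Finset.univ : Finset (Finset (Fin S))).filter fun P => P.card ≤ q).card

/-- Expand (1 + 1/X)^S ≤ exp(S/X) over all subsets: each one with at most q elements contributes at
least X^(-q). -/
lemma smallSubsets_le (S q X : ℕ) (hX : 1 ≤ X) :
    (smallSubsets S q : ℝ) ≤ X ^ q * Real.exp (S / X) := by
  have hX' : (1 : ℝ) ≤ X := by exact_mod_cast hX
  have h1 : ((1 : ℝ) / X + 1) ^ S = ∑ P : Finset (Fin S), ((1 : ℝ) / X) ^ P.card := by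
    have := Finset.prod_add (fun _ : Fin S => (1 : ℝ) / X) (fun _ => 1) Finset.univ
    simpa [Finset.prod_const] using this
  have h2 : ((1 : ℝ) / X + 1) ^ S ≤ Real.exp (S / X) := by
    calc ((1 : ℝ) / X + 1) ^ S ≤ Real.exp (1 / X) ^ S :=
          pow_le_pow_left₀ (by positivity) (Real.add_one_le_exp _) _
      _ = Real.exp (S / X) := by rw [← Real.exp_nat_mul]; ring_nf
  have h3 : (smallSubsets S q : ℝ) * ((1 : ℝ) / X) ^ q ≤
      ∑ P : Finset (Fin S), ((1 : ℝ) / X) ^ P.card := by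
    rw [smallSubsets, ← nsmul_eq_mul]
    refine (Finset.card_nsmul_le_sum _ (fun P : Finset (Fin S) => ((1 : ℝ) / X) ^ P.card) _
      fun P hP => ?_).trans
      (Finset.sum_le_sum_of_subset_of_nonneg (Finset.filter_subset _ _) fun _ _ _ => by positivity)
    refine pow_le_pow_of_le_one (by positivity) ?_ (Finset.mem_filter.1 hP).2
    rw [div_le_one (by positivity)]
    exact hX'
  have h4 := h3.trans (h1 ▸ h2)
  calc (smallSubsets S q : ℝ) = X ^ q * (smallSubsets S q * ((1 : ℝ) / X) ^ q) := by
        rw [one_div, inv_pow]; field_simp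
    _ ≤ _ := by gcongr

lemma prod_le_sum_div_pow {ι : Type} [Fintype ι] [Nonempty ι] (z : ι → ℝ) (hz : ∀ i, 0 ≤ z i) :
    ∏ i, z i ≤ ((∑ i, z i) / Fintype.card ι) ^ Fintype.card ι := by
  have hc : (0 : ℝ) < Fintype.card ι := by exact_mod_cast Fintype.card_pos
  have := Real.geom_mean_le_arith_mean Finset.univ (fun _ : ι => (1 : ℝ)) z
    (fun _ _ => zero_le_one) (by simpa using hc) fun i _ => hz i
  simp only [Real.rpow_one, Finset.sum_const, Finset.card_univ, nsmul_eq_mul, mul_one,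
    one_mul] at this
  have hp : 0 ≤ ∏ i, z i := Finset.prod_nonneg fun i _ => hz i
  calc ∏ i, z i = ((∏ i, z i) ^ ((Fintype.card ι : ℝ)⁻¹)) ^ Fintype.card ι :=
        (Real.rpow_inv_natCast_pow hp Fintype.card_ne_zero).symm
    _ ≤ _ := pow_le_pow_left₀ (by positivity) this _

section Counting

variable {ι κ : Type} [Fintype ι] [DecidableEq ι] [Fintype κ] [DecidableEq κ]

/-- Functions with Boolean values which agree with a given one on `U` are rare. -/
lemma card_agree_mul_le (f₀ : κ → Bool) (U : Finset κ) (Y : Finset (κ → Bool))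
    (h : ∀ f ∈ Y, ∀ x ∈ U, f x = f₀ x) : Y.card * 2 ^ U.card ≤ 2 ^ Fintype.card κ := by
  have h1 : Fintype.card (Y × (U → Bool)) ≤ Fintype.card (κ → Bool) := by
    -- Members of `Y` differ only off `U`, so overwriting their values on `U` loses nothing.
    refine Fintype.card_le_of_injective
      (fun p x => if hx : x ∈ U then p.2 ⟨x, hx⟩ else p.1.1 x) ?_
    rintro ⟨⟨f, hf⟩, g⟩ ⟨⟨f', hf'⟩, g'⟩ heq
    simp only [Prod.mk.injEq, Subtype.mk.injEq]
    constructor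
    · funext x
      by_cases hx : x ∈ U
      · rw [h f hf x hx, h f' hf' x hx]
      · simpa [hx] using congrFun heq x
    · funext x
      simpa using congrFun heq x
  simpa using h1

/-- Few families of permutations have all their graphs inside a small set. -/
lemma card_perms_le [Nonempty ι] {h : ℕ} (hh : 0 < h) (X : Finset (ι → Equiv.Perm (Fin h)))
    (U : Finset (ι × Fin h × Fin h)) (hU : ∀ τ ∈ X, ∀ i r, (i, r, τ i r) ∈ U) :
    (X.card : ℝ) ≤ ((U.card : ℝ) / (Fintype.card ι * h : ℕ)) ^ (Fintype.card ι * h) := by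
  have : Nonempty (Fin h) := ⟨⟨0, hh⟩⟩
  -- A family in `X` picks one point from each fibre of `U`. The fibre sizes add up to `U.card`, so
  -- AM-GM bounds their product.
  let F : ι × Fin h → Finset (Fin h) := fun x => Finset.univ.filter fun k => (x.1, x.2, k) ∈ U
  have h1 : X.card ≤ (Fintype.piFinset F).card := by
    refine Finset.card_le_card_of_injOn (fun τ x => τ x.1 x.2) (fun τ hτ => ?_) ?_
    · simp only [Finset.mem_coe, Fintype.mem_piFinset, F, Finset.mem_filter]
      exact fun x => ⟨Finset.mem_univ _, hU τ hτ _ _⟩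
    · intro τ _ τ' _ heq
      funext i
      ext r
      exact congrArg Fin.val (congrFun heq (i, r))
  have h2 : ∑ x, (F x).card = U.card := by
    have e : ∀ x : ι × Fin h, (F x).card =
        (U.filter fun y => ((y.1, y.2.1) : ι × Fin h) = x).card := fun x => by
      refine Finset.card_bij (fun k _ => (x.1, x.2, k)) ?_ ?_ ?_
      · intro k hk
        simp only [F, Finset.mem_filter] at hk ⊢
        exact ⟨hk.2, trivial⟩
      · intro k _ k' _ hkk
        simpa using hkk
      · rintro ⟨i, r, k⟩ hy
        simp only [F, Finset.mem_filter] at hy ⊢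
        obtain ⟨hy, rfl⟩ := hy
        exact ⟨k, ⟨Finset.mem_univ _, hy⟩, rfl⟩
    simp_rw [e]
    exact (Finset.card_eq_sum_card_fiberwise fun _ _ => Finset.mem_coe.2 (Finset.mem_univ _)).symm
  have h3 := prod_le_sum_div_pow (fun x : ι × Fin h => ((F x).card : ℝ)) fun _ => by positivity
  rw [Fintype.card_prod, Fintype.card_fin] at h3
  rw [Fintype.card_piFinset] at h1
  calc (X.card : ℝ) ≤ ((∏ x, (F x).card : ℕ) : ℝ) := by exact_mod_cast h1
    _ = ∏ x, ((F x).card : ℝ) := by push_cast; rfl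
    _ ≤ _ := h3
    _ = _ := by rw [← h2]; push_cast; rfl

lemma exists_fiber {α β : Type} [Fintype α] [Fintype β] [DecidableEq β] [Nonempty β] (s : Finset α)
    (t : Finset β) (f : α → β) (hf : ∀ a ∈ s, f a ∈ t) (hs : s.Nonempty) :
    ∃ y ∈ t, s.card ≤ t.card * (s.filter fun a => f a = y).card := by
  by_contra! hlt
  obtain ⟨a, ha⟩ := hs
  have ht : t.Nonempty := ⟨f a, hf a ha⟩
  have h1 := Finset.card_eq_sum_card_fiberwise (f := f) (s := s) (t := t) (fun a ha => hf a ha)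
  have h2 : ∑ y ∈ t, t.card * (s.filter fun a => f a = y).card < ∑ _y ∈ t, s.card :=
    Finset.sum_lt_sum_of_nonempty ht hlt
  rw [← Finset.mul_sum, ← h1, Finset.sum_const, smul_eq_mul] at h2
  exact lt_irrefl _ h2

/-- If the agreement of short descriptions of two inputs `T`, `T₀` on a small certificate for `T₀` and `τ`
forces `T` and `T₀` to agree on the graphs of the permutations `τ`, then there are many certificates. -/
theorem exists_card_bounds [Nonempty ι] {h S q : ℕ} {Δ : Type} [Fintype Δ] [DecidableEq Δ]
    [Nonempty Δ] (hh : 0 < h)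
    (P : (ι × Fin h × Fin h → Bool) → (ι → Equiv.Perm (Fin h)) → Finset (Fin S))
    (hP : ∀ T τ, (P T τ).card ≤ q) (desc : (ι × Fin h × Fin h → Bool) → Fin S → Δ)
    (hagree : ∀ T₀ T τ, (∀ p ∈ P T₀ τ, desc T p = desc T₀ p) →
      ∀ i r, T (i, r, τ i r) = T₀ (i, r, τ i r)) :
    ∃ u : ℕ, 2 ^ u ≤ smallSubsets S q * Fintype.card Δ ^ q ∧
      ((h.factorial ^ Fintype.card ι : ℕ) : ℝ) ≤ smallSubsets S q *
        ((u : ℝ) / (Fintype.card ι * h : ℕ)) ^ (Fintype.card ι * h) := by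
  classical
  set Pf := (Finset.univ : Finset (Finset (Fin S))).filter fun P => P.card ≤ q
  have hP' : ∀ T τ, P T τ ∈ Pf := fun T τ => by simpa [Pf] using hP T τ
  -- Three pigeonholes: `Q T` is a certificate shared by many families for the input `T`, `Q₁` is
  -- one that many inputs have as `Q T`, and `g` fixes the descriptions of its pieces.
  have h1 : ∀ T, ∃ Q ∈ Pf, (Finset.univ : Finset (ι → Equiv.Perm (Fin h))).card ≤ Pf.card *
      (Finset.univ.filter fun τ => P T τ = Q).card := fun T =>
    exists_fiber _ Pf (P T) (fun τ _ => hP' T τ) Finset.univ_nonempty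
  choose Q hQ hQcard using h1
  obtain ⟨Q₁, hQ₁, hY₁⟩ := exists_fiber (Finset.univ : Finset (ι × Fin h × Fin h → Bool)) Pf Q
    (fun T _ => hQ T) Finset.univ_nonempty
  set Y₁ := Finset.univ.filter fun T => Q T = Q₁
  have hpos : 0 < (Finset.univ : Finset (ι × Fin h × Fin h → Bool)).card :=
    Finset.univ_nonempty.card_pos
  have hY₁pos : Y₁.Nonempty := by
    rw [← Finset.card_pos]; exact Nat.pos_of_mul_pos_left (hpos.trans_le hY₁)
  obtain ⟨g, -, hY⟩ := exists_fiber Y₁ (Finset.univ : Finset (Q₁ → Δ)) (fun T p => desc T p)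
    (fun _ _ => Finset.mem_univ _) hY₁pos
  set Y := Y₁.filter fun T => (fun p : Q₁ => desc T p) = g
  have hYpos : Y.Nonempty := by
    rw [← Finset.card_pos]; exact Nat.pos_of_mul_pos_left (hY₁pos.card_pos.trans_le hY)
  obtain ⟨T₀, hT₀⟩ := hYpos
  have hT₀Q : Q T₀ = Q₁ := (Finset.mem_filter.1 (Finset.mem_filter.1 hT₀).1).2
  set X := Finset.univ.filter fun τ => P T₀ τ = Q₁
  have hX : (Finset.univ : Finset (ι → Equiv.Perm (Fin h))).card ≤ Pf.card * X.card := by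
    have := hQcard T₀
    rwa [hT₀Q] at this
  set U := X.biUnion fun τ => Finset.univ.image fun x : ι × Fin h => (x.1, x.2, τ x.1 x.2)
  have hU : ∀ τ ∈ X, ∀ i r, (i, r, τ i r) ∈ U := fun τ hτ i r =>
    Finset.mem_biUnion.2 ⟨τ, hτ, Finset.mem_image.2 ⟨(i, r), Finset.mem_univ _, rfl⟩⟩
  have hYU : ∀ T ∈ Y, ∀ x ∈ U, T x = T₀ x := by
    intro T hT x hx
    obtain ⟨τ, hτ, hx⟩ := Finset.mem_biUnion.1 hx
    obtain ⟨⟨i, r⟩, -, rfl⟩ := Finset.mem_image.1 hx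
    refine hagree T₀ T τ (fun p hp => ?_) i r
    rw [(Finset.mem_filter.1 hτ).2] at hp
    exact congrFun ((Finset.mem_filter.1 hT).2.trans (Finset.mem_filter.1 hT₀).2.symm) ⟨p, hp⟩
  refine ⟨U.card, ?_, ?_⟩
  · have hc := card_agree_mul_le T₀ U Y hYU
    have hQ₁c : Q₁.card ≤ q := (Finset.mem_filter.1 hQ₁).2
    have hall : (Finset.univ : Finset (ι × Fin h × Fin h → Bool)).card =
        2 ^ Fintype.card (ι × Fin h × Fin h) := by
      rw [Finset.card_univ, Fintype.card_fun, Fintype.card_bool]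
    have hΔ : (Finset.univ : Finset (Q₁ → Δ)).card ≤ Fintype.card Δ ^ q := by
      rw [Finset.card_univ, Fintype.card_fun, Fintype.card_coe]
      exact Nat.pow_le_pow_right Fintype.card_pos hQ₁c
    rw [hall] at hY₁
    have : 2 ^ U.card * 2 ^ Fintype.card (ι × Fin h × Fin h) ≤
        (Pf.card * Fintype.card Δ ^ q) * 2 ^ Fintype.card (ι × Fin h × Fin h) :=
      calc 2 ^ U.card * 2 ^ Fintype.card (ι × Fin h × Fin h)
          ≤ 2 ^ U.card * (Pf.card * (Fintype.card Δ ^ q * Y.card)) := by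
            gcongr; exact hY₁.trans (by gcongr; exact hY.trans (by gcongr))
        _ = (Pf.card * Fintype.card Δ ^ q) * (Y.card * 2 ^ U.card) := by ring
        _ ≤ _ := by gcongr
    exact Nat.le_of_mul_le_mul_right this (by positivity)
  · have hc := card_perms_le hh X U hU
    rw [Finset.card_univ, Fintype.card_fun, Fintype.card_perm, Fintype.card_fin] at hX
    calc ((h.factorial ^ Fintype.card ι : ℕ) : ℝ) ≤ ((Pf.card * X.card : ℕ) : ℝ) := by
          exact_mod_cast hX
      _ = smallSubsets S q * X.card := by push_cast; rfl
      _ ≤ _ := by gcongr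

end Counting

/-! ### Epochs of updates and the cells they touch -/

section Epochs

variable {w b d : ℕ}

/-- The concatenation of the lists `E (j - 1), …, E 0`. -/
def epochs {α : Type} (E : ℕ → List α) : ℕ → List α
  | 0 => []
  | j + 1 => E j ++ epochs E j

lemma mem_epochs {α : Type} {E : ℕ → List α} {j : ℕ} {x : α} :
    x ∈ epochs E j ↔ ∃ i < j, x ∈ E i := by
  induction j with
  | zero => simp [epochs]
  | succ j ih =>
    simp only [epochs, List.mem_append, ih, Nat.lt_succ_iff_lt_or_eq]
    constructor
    · rintro (hx | ⟨i, hi, hx⟩)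
      exacts [⟨j, Or.inr rfl, hx⟩, ⟨i, Or.inl hi, hx⟩]
    · rintro ⟨i, hi | rfl, hx⟩
      exacts [Or.inr ⟨i, hi, hx⟩, Or.inl hx]

lemma nodup_epochs {α : Type} {E : ℕ → List α} (h : ∀ i, (E i).Nodup)
    (hE : ∀ i j x, x ∈ E i → x ∈ E j → i = j) (j : ℕ) : (epochs E j).Nodup := by
  induction j with
  | zero => simp [epochs]
  | succ j ih =>
    refine List.nodup_append.2 ⟨h j, ih, fun x hx y hy hxy => ?_⟩
    obtain ⟨i, hi, hy⟩ := mem_epochs.1 hy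
    exact hi.ne' (hE j i x hx (hxy ▸ hy))

/-- The addresses probed by the updates of `E i` when the updates of `epochs E j` are performed
from the memory `M`. -/
def DataStructure.touchedAt (D : DataStructure w b d) (E : ℕ → List (Vertex b d)) :
    Memory w → ℕ → ℕ → Finset ℕ
  | _, 0, _ => ∅
  | M, j + 1, i => if i = j then D.touched M (E j) else D.touchedAt E (D.run M (E j)) j i

lemma DataStructure.exists_touchedAt_of_ne (D : DataStructure w b d) (E : ℕ → List (Vertex b d))
    (M : Memory w) (j a : ℕ) (h : D.run M (epochs E j) a ≠ M a) :
    ∃ i < j, a ∈ D.touchedAt E M j i := by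
  induction j generalizing M with
  | zero => exact absurd rfl h
  | succ j ih =>
    by_cases ha : a ∈ D.touched M (E j)
    · exact ⟨j, j.lt_succ_self, by simpa [touchedAt] using ha⟩
    · rw [epochs, D.run_append, ← D.run_of_notMem ha] at h
      obtain ⟨i, hi, hi'⟩ := ih _ h
      exact ⟨i, hi.trans j.lt_succ_self, by simpa [touchedAt, hi.ne] using hi'⟩

/-- If two histories agree in the epochs in which `t` and `t'` agree, then a cell in which they end
up differently was touched in an epoch in which `t` and `t'` differ. -/
lemma DataStructure.exists_touchedAt_of_ne_run (D : DataStructure w b d)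
    (E E' : ℕ → List (Vertex b d)) (t t' B : ℕ)
    (hE : ∀ j, t / B ^ j = t' / B ^ j → E j = E' j) (M : Memory w) (j a : ℕ)
    (h : D.run M (epochs E j) a ≠ D.run M (epochs E' j) a) :
    ∃ i < j, t / B ^ i ≠ t' / B ^ i ∧ (a ∈ D.touchedAt E M j i ∨ a ∈ D.touchedAt E' M j i) := by
  induction j generalizing M with
  | zero => exact absurd rfl h
  | succ j ih =>
    by_cases hj : t / B ^ j = t' / B ^ j
    · rw [epochs, epochs, D.run_append, D.run_append, ← hE j hj] at h
      obtain ⟨i, hi, hne, hi'⟩ := ih _ h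
      refine ⟨i, hi.trans j.lt_succ_self, hne, ?_⟩
      simpa only [touchedAt, hi.ne, if_false, ← hE j hj] using hi'
    -- Once the quotients differ at j they differ at every lower level. All remaining epochs then
    -- qualify, and it is enough that one of the two histories changed the cell from `M`.
    · have hlow : ∀ i < j + 1, t / B ^ i ≠ t' / B ^ i := fun i hi heq => hj <| by
        rw [show j = i + (j - i) by omega, pow_add, ← Nat.div_div_eq_div_mul,
          ← Nat.div_div_eq_div_mul, heq]
      by_cases h1 : D.run M (epochs E (j + 1)) a = M a
      · rw [h1] at h
        obtain ⟨i, hi, hi'⟩ := D.exists_touchedAt_of_ne E' M (j + 1) a h.symm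
        exact ⟨i, hi, hlow i hi, Or.inr hi'⟩
      · obtain ⟨i, hi, hi'⟩ := D.exists_touchedAt_of_ne E M (j + 1) a h1
        exact ⟨i, hi, hlow i hi, Or.inl hi'⟩

lemma DataStructure.Solves.card_touchedAt_le {D : DataStructure w b d} {V : Variant} {tu tq : ℕ}
    (hD : D.Solves V tu tq) (E : ℕ → List (Vertex b d)) (σ : List (Vertex b d)) (j i : ℕ)
    (h : (σ ++ epochs E j).Nodup) :
    (D.touchedAt E (D.memoryAfter σ) j i).card ≤ (E i).length * tu := by
  induction j generalizing σ with
  | zero => simp [touchedAt]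
  | succ j ih =>
    rw [epochs, ← List.append_assoc] at h
    rw [touchedAt]
    split_ifs with hi
    · subst hi
      exact hD.card_touched_le σ _ (h.sublist (List.sublist_append_left _ _))
    · rw [← memoryAfter_append]
      exact ih _ h

end Epochs

/-! ### Breaks in space-time -/

/-- The number of changes in the contents of the memory along all versions, one address after
the other. -/
lemma card_breaks_le {w b d α tu : ℕ} (hb : 0 < b) (mem : ℕ → Memory w) (M₀ : Memory w)
    (W : ℕ → ℕ → Finset ℕ) (addr idx : ℕ → ℕ) (hidx : ∀ p < α, idx (addr p) = p)
    (h1 : ∀ t a, mem t a ≠ M₀ a → ∃ i < d, a ∈ W t i)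
    (h2 : ∀ t a, mem t a ≠ mem (t + 1) a →
      ∃ i < d, t / b ^ i ≠ (t + 1) / b ^ i ∧ (a ∈ W t i ∨ a ∈ W (t + 1) i))
    (hW : ∀ t i, (W t i).card ≤ b ^ (i + 1) * tu) :
    ((Finset.range (α * b ^ d)).filter fun k => k + 1 < α * b ^ d ∧
      mem ((k + 1) % b ^ d) (addr ((k + 1) / b ^ d)) ^^^ M₀ (addr ((k + 1) / b ^ d)) ≠
        mem (k % b ^ d) (addr (k / b ^ d)) ^^^ M₀ (addr (k / b ^ d))).card ≤
      2 * d * b ^ (d + 1) * tu := by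
  set n := b ^ d with hn
  have hn0 : 0 < n := by positivity
  -- Position `idx a * n + t` stands for address `a` in version t. Epoch i is renewed after the
  -- b^(d-i) versions with b^i ∣ t + 1. A touch in version t may cause a break at its own position,
  -- one in version t + 1 at the position before, whence the `- 1`; truncation at 0 is harmless.
  let C : Finset ℕ := (Finset.range d).biUnion fun i =>
    ((Finset.range n).filter fun t => b ^ i ∣ t + 1).biUnion fun t =>
      (W t i).image (fun a => idx a * n + t) ∪
        (W ((t + 1) % n) i).image fun a => idx a * n + (t + 1) % n - 1
  have hC : C.card ≤ 2 * d * b ^ (d + 1) * tu := by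
    have h3 : ∀ i ∈ Finset.range d, (((Finset.range n).filter fun t => b ^ i ∣ t + 1).biUnion
        fun t => (W t i).image (fun a => idx a * n + t) ∪
          (W ((t + 1) % n) i).image fun a => idx a * n + (t + 1) % n - 1).card ≤
        2 * b ^ (d + 1) * tu := by
      intro i hi
      refine (Finset.card_biUnion_le_card_mul _ _ (2 * (b ^ (i + 1) * tu)) fun t _ => ?_).trans ?_
      · refine (Finset.card_union_le _ _).trans ?_
        rw [two_mul]
        exact add_le_add (Finset.card_image_le.trans (hW _ _)) (Finset.card_image_le.trans (hW _ _))
      · have hid : i ≤ d := (Finset.mem_range.1 hi).le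
        rw [Nat.card_multiples, hn, Nat.pow_div hid hb]
        apply le_of_eq
        calc b ^ (d - i) * (2 * (b ^ (i + 1) * tu))
            = 2 * (b ^ (d - i) * b ^ (i + 1)) * tu := by ring
          _ = _ := by rw [← pow_add]; congr 3; omega
    refine (Finset.card_biUnion_le_card_mul _ _ _ h3).trans (le_of_eq ?_)
    rw [Finset.card_range]
    ring
  refine (Finset.card_le_card fun k hk => ?_).trans hC
  rw [Finset.mem_filter, Finset.mem_range] at hk
  obtain ⟨-, hk, hne⟩ := hk
  have hp : (k + 1) / n < α := Nat.div_lt_of_lt_mul (by rwa [mul_comm])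
  have hk1 := Nat.div_add_mod k n
  have hk1' := Nat.div_add_mod (k + 1) n
  have hmod := Nat.mod_lt k hn0
  rw [mul_comm] at hk1 hk1'
  have hlt : k / n < α := (Nat.div_le_div_right k.le_succ).trans_lt hp
  by_cases hwrap : k % n + 1 < n
  · have hq : (k + 1) / n = k / n := by
      rw [Nat.div_eq_iff hn0]; constructor
      · omega
      · omega
    have hr : (k + 1) % n = k % n + 1 := by rw [hq] at hk1'; omega
    rw [hq, hr] at hne
    have hne' : mem (k % n) (addr (k / n)) ≠ mem (k % n + 1) (addr (k / n)) := fun heq =>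
      hne (by rw [heq])
    obtain ⟨i, hi, hdiv, ha⟩ := h2 _ _ hne'
    have hdvd : b ^ i ∣ k % n + 1 := by
      by_contra hnd
      exact hdiv (Nat.succ_div_of_not_dvd hnd).symm
    refine Finset.mem_biUnion.2 ⟨i, Finset.mem_range.2 hi, Finset.mem_biUnion.2
      ⟨k % n, Finset.mem_filter.2 ⟨Finset.mem_range.2 hmod, hdvd⟩, ?_⟩⟩
    rw [Finset.mem_union, Finset.mem_image, Finset.mem_image]
    refine ha.imp (fun ha => ⟨_, ha, ?_⟩) fun ha => ?_
    · rw [hidx _ hlt]; exact hk1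
    · rw [Nat.mod_eq_of_lt hwrap]
      refine ⟨_, ha, ?_⟩
      rw [hidx _ hlt]; omega
  · have hr0 : k % n + 1 = n := by omega
    have hq : (k + 1) / n = k / n + 1 := by
      rw [Nat.div_eq_iff hn0]; constructor
      · rw [Nat.add_mul]; omega
      · rw [Nat.add_mul]; omega
    have hr : (k + 1) % n = 0 := by rw [hq, Nat.add_mul] at hk1'; omega
    rw [hr, hq] at hne
    -- At the passage to the next address, the XOR with `M₀` makes untouched contents zero on both
    -- sides, so a break needs one of the two cells to have changed.
    have hor : mem (k % n) (addr (k / n)) ≠ M₀ (addr (k / n)) ∨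
        mem 0 (addr (k / n + 1)) ≠ M₀ (addr (k / n + 1)) := by
      by_contra! hboth
      exact hne (by rw [hboth.1, hboth.2, BitVec.xor_self, BitVec.xor_self])
    have hfin : ∀ i < d, b ^ i ∣ k % n + 1 := fun i hi => by
      rw [hr0]; exact pow_dvd_pow b hi.le
    rw [hq] at hp
    obtain ha | ha := hor
    · obtain ⟨i, hi, ha⟩ := h1 _ _ ha
      refine Finset.mem_biUnion.2 ⟨i, Finset.mem_range.2 hi, Finset.mem_biUnion.2
        ⟨k % n, Finset.mem_filter.2 ⟨Finset.mem_range.2 hmod, hfin i hi⟩, ?_⟩⟩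
      refine Finset.mem_union_left _ (Finset.mem_image.2 ⟨_, ha, ?_⟩)
      rw [hidx _ hlt]; exact hk1
    · obtain ⟨i, hi, ha⟩ := h1 _ _ ha
      refine Finset.mem_biUnion.2 ⟨i, Finset.mem_range.2 hi, Finset.mem_biUnion.2
        ⟨k % n, Finset.mem_filter.2 ⟨Finset.mem_range.2 hmod, hfin i hi⟩, ?_⟩⟩
      refine Finset.mem_union_right _ (Finset.mem_image.2 ?_)
      rw [hr0, Nat.mod_self]
      refine ⟨_, ha, ?_⟩
      rw [hidx _ hp, Nat.add_mul]; omega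

/-! ### The hard instance and its unmarked paths -/

section Instance

variable {h b d : ℕ}

/-- A coordinate `i` together with values for all other coordinates. -/
abbrev Group (b d : ℕ) : Type := Σ i : Fin d, ({j : Fin d // j ≠ i} → Fin b)

/-- The group of the vector `y` at the coordinate `i`. -/
def group (i : Fin d) (y : Fin d → Fin b) : Group b d := ⟨i, fun j => y j⟩

lemma group_update (i : Fin d) (y : Fin d → Fin b) (z : Fin b) :
    group i (Function.update y i z) = group i y := by
  simp only [group, Sigma.mk.injEq, heq_eq_eq, true_and]
  funext j
  exact Function.update_of_ne j.2 _ _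

/-- The data which determine the updates of all versions. -/
abbrev Input (h b d : ℕ) : Type := Group b d × Fin h × Fin h → Bool

/-- In the version `u`, the vertex reached by the `i`-th branching choice of `y` is not marked. -/
def Matches (e : Fin b ≃ Fin h × Bool) (T : Input h b d) (u y : Fin d → Fin b) (i : Fin d) : Prop :=
  (e (y i)).2 = xor (e (u i)).2 (T (group i y, (e (u i)).1, (e (y i)).1))

/-- The branching choices on the way to the vertex `x`, continued by `u`. -/
def mix (x : Vertex b d) (u : Fin d → Fin b) : Fin d → Fin b :=
  fun j => if hj : (j : ℕ) < x.1 then x.2 ⟨j, hj⟩ else u j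

/-- The digits of `t` in base `b`. -/
def digits (b d : ℕ) [NeZero b] (t : ℕ) : Fin d → Fin b := fun j => Fin.ofNat b (t / b ^ (j : ℕ))

lemma digits_congr [NeZero b] {t t' i : ℕ} (htt : t / b ^ i = t' / b ^ i) {j : Fin d}
    (hij : i ≤ j) : digits b d t j = digits b d t' j := by
  simp only [digits]
  congr 1
  rw [show (j : ℕ) = i + (j - i) by omega, pow_add, ← Nat.div_div_eq_div_mul,
    ← Nat.div_div_eq_div_mul, htt]

lemma exists_digits_eq [NeZero b] (u : Fin d → Fin b) : ∃ t < b ^ d, digits b d t = u := by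
  refine ⟨finFunctionFinEquiv u, (finFunctionFinEquiv u).2, ?_⟩
  conv_rhs => rw [← finFunctionFinEquiv.symm_apply_apply u]
  rfl

/-- The updates performed before the first epoch. -/
def baseList : Variant → List (Vertex b d)
  | .incremental => []
  | .decremental => [⟨0, Fin.elim0⟩]

open Classical in
/-- The updates of the vertices at depth `i + 1` in the version `t`. -/
noncomputable def epoch [NeZero b] (e : Fin b ≃ Fin h × Bool) (V : Variant) (T : Input h b d)
    (t i : ℕ) : List (Vertex b d) :=
  ((Finset.univ : Finset (Vertex b d)).filter fun x => ∃ hi : i < d, (x.1 : ℕ) = i + 1 ∧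
    (Matches e T (digits b d t) (mix x (digits b d t)) ⟨i, hi⟩ ↔ V = .decremental)).toList

section Walk

variable (e : Fin b ≃ Fin h × Bool) (T : Input h b d)

/-- One step of an unmarked path: the coordinate `i` of `y` is changed. -/
def step (τ : Group b d → Equiv.Perm (Fin h)) (i : Fin d) (y : Fin d → Fin b) : Fin d → Fin b :=
  Function.update y i (e.symm (τ (group i y) (e (y i)).1,
    xor (e (y i)).2 (T (group i y, (e (y i)).1, τ (group i y) (e (y i)).1))))

/-- The group ignores coordinate i, so within a group the step permutes the labels by τ and, for
each label, adds a fixed bit. -/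
lemma step_surjective (τ : Group b d → Equiv.Perm (Fin h)) (i : Fin d) :
    Function.Surjective (step e T τ i) := by
  intro y
  refine ⟨Function.update y i (e.symm ((τ (group i y)).symm (e (y i)).1,
    xor (e (y i)).2 (T (group i y, (τ (group i y)).symm (e (y i)).1, (e (y i)).1)))), ?_⟩
  simp [step, group_update]

/-- The first `k` steps of the unmarked path for the version `u`. -/
def walk (τ : Group b d → Equiv.Perm (Fin h)) (u : Fin d → Fin b) : ℕ → Fin d → Fin b
  | 0 => u
  | k + 1 => if hk : k < d then step e T τ ⟨k, hk⟩ (walk τ u k) else walk τ u k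

lemma walk_surjective (τ : Group b d → Equiv.Perm (Fin h)) (k : ℕ) :
    Function.Surjective fun u => walk e T τ u k := by
  induction k with
  | zero => exact Function.surjective_id
  | succ k ih =>
    by_cases hk : k < d
    · simp only [walk, hk, dif_pos]
      exact (step_surjective e T τ ⟨k, hk⟩).comp ih
    · simpa only [walk, hk, dif_neg, not_false_eq_true] using ih

lemma walk_of_le (τ : Group b d → Equiv.Perm (Fin h)) (u : Fin d → Fin b) {k : ℕ} {j : Fin d}
    (hkj : k ≤ j) : walk e T τ u k j = u j := by
  induction k with
  | zero => rfl
  | succ k ih =>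
    rw [walk, dif_pos (by omega), step, Function.update_of_ne, ih (by omega)]
    intro heq
    simp [heq] at hkj

lemma walk_of_lt (τ : Group b d → Equiv.Perm (Fin h)) (u : Fin d → Fin b) {k l : ℕ} {j : Fin d}
    (hjk : j < k) (hkl : k ≤ l) : walk e T τ u l j = walk e T τ u k j := by
  induction l, hkl using Nat.le_induction with
  | base => rfl
  | succ l hl ih =>
    rw [← ih, walk]
    split_ifs with hld
    · refine Function.update_of_ne (fun heq => ?_) _ _
      have := congrArg Fin.val heq
      simp at this
      omega
    · rfl

/-- After i + 1 steps the coordinates up to i are final, and the later ones are still those of `u`.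
-/
lemma mix_pathVertex_walk (τ : Group b d → Equiv.Perm (Fin h)) (u : Fin d → Fin b) (i : Fin d) :
    mix (pathVertex (walk e T τ u d) i.succ) u = walk e T τ u (i + 1) := by
  funext j
  unfold mix
  split_ifs with hj
  · exact walk_of_lt e T τ u (by simpa [pathVertex] using hj) (by omega)
  · refine (walk_of_le e T τ u ?_).symm
    simp [pathVertex] at hj
    omega

/-- The step takes its bit from `T`, and the bit of the version cancels. For `T' = T` the path is
thus unmarked; for any other `T'` being unmarked reveals one entry. -/
lemma matches_walk_iff (T' : Input h b d) (τ : Group b d → Equiv.Perm (Fin h)) (u : Fin d → Fin b)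
    (i : Fin d) : Matches e T' u (walk e T τ u (i + 1)) i ↔
      T' (group i (walk e T τ u i), (e (u i)).1, τ (group i (walk e T τ u i)) (e (u i)).1) =
        T (group i (walk e T τ u i), (e (u i)).1, τ (group i (walk e T τ u i)) (e (u i)).1) := by
  have h1 : walk e T τ u (i + 1) = step e T τ i (walk e T τ u i) := by
    rw [walk, dif_pos i.2]
  have h2 : walk e T τ u i i = u i := walk_of_le e T τ u le_rfl
  rw [Matches, h1, step, group_update, h2]
  simp only [Function.update_self, Equiv.apply_symm_apply, Bool.xor_right_inj]
  exact eq_comm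

end Walk

variable [NeZero b] (e : Fin b ≃ Fin h × Bool) (V : Variant) (T : Input h b d)

lemma mem_epoch {t i : ℕ} {x : Vertex b d} : x ∈ epoch e V T t i ↔
    ∃ hi : i < d, (x.1 : ℕ) = i + 1 ∧
      (Matches e T (digits b d t) (mix x (digits b d t)) ⟨i, hi⟩ ↔ V = .decremental) := by
  simp [epoch]

/-- A vertex at depth i + 1 supplies the coordinates up to i itself, so only the digits of t from i
onwards enter. -/
lemma epoch_congr {t t' i : ℕ} (htt : t / b ^ i = t' / b ^ i) :
    epoch e V T t i = epoch e V T t' i := by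
  classical
  unfold epoch
  congr 1
  refine Finset.filter_congr fun x _ => exists_congr fun hi => and_congr_right fun hx => ?_
  have h1 : mix x (digits b d t) = mix x (digits b d t') := by
    funext j
    unfold mix
    split_ifs with hj
    · rfl
    · exact digits_congr htt (by omega)
  have h2 : digits b d t ⟨i, hi⟩ = digits b d t' ⟨i, hi⟩ := digits_congr htt le_rfl
  rw [Matches, Matches, h1, h2]

lemma length_epoch_le (t i : ℕ) : (epoch e V T t i).length ≤ b ^ (i + 1) := by
  classical
  rw [epoch, Finset.length_toList]
  by_cases hi : i < d
  · calc _ ≤ (Finset.univ.image fun f : Fin (i + 1) → Fin b =>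
          (⟨⟨i + 1, by omega⟩, f⟩ : Vertex b d)).card := by
          refine Finset.card_le_card fun x hx => ?_
          obtain ⟨-, -, hx, -⟩ := Finset.mem_filter.1 hx
          obtain ⟨⟨k, hk⟩, f⟩ := x
          obtain rfl : k = i + 1 := hx
          exact Finset.mem_image.2 ⟨f, Finset.mem_univ _, rfl⟩
      _ ≤ _ := Finset.card_image_le
      _ = b ^ (i + 1) := by simp
  · simp [hi]

lemma nodup_epochs_epoch (t : ℕ) : (baseList V ++ epochs (epoch e V T t) d).Nodup := by
  have h1 : (epochs (epoch e V T t) d).Nodup := by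
    refine nodup_epochs (fun i => Finset.nodup_toList _) (fun i j x hx hx' => ?_) d
    obtain ⟨_, h1, _⟩ := (mem_epoch e V T).1 hx
    obtain ⟨_, h2, _⟩ := (mem_epoch e V T).1 hx'
    omega
  cases V with
  | incremental => simpa [baseList] using h1
  | decremental =>
    refine List.nodup_cons.2 ⟨fun hmem => ?_, h1⟩
    obtain ⟨i, _, hx⟩ := mem_epochs.1 hmem
    obtain ⟨_, hx, _⟩ := (mem_epoch e _ T).1 hx
    simp at hx

/-- The memory in the version `t`. -/
noncomputable def memAt {w : ℕ} (D : DataStructure w b d) (t : ℕ) : Memory w :=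
  D.run (D.memoryAfter (baseList V)) (epochs (epoch e V T t) d)

/-- Both variants reach the same marking: either the vertices that do not match get marked, or those
that match get unmarked. The root is never marked in the first case and is unmarked by `baseList` in
the second. -/
lemma exists_marked_iff (t : ℕ) (v : Leaf b d) :
    (∃ i, pathVertex v i ∈ V.marked (baseList V ++ epochs (epoch e V T t) d)) ↔
      ∃ i : Fin d, ¬ Matches e T (digits b d t) (mix (pathVertex v i.succ) (digits b d t)) i := by
  have hmem : ∀ i : Fin d, pathVertex v i.succ ∈ baseList V ++ epochs (epoch e V T t) d ↔
      (Matches e T (digits b d t) (mix (pathVertex v i.succ) (digits b d t)) i ↔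
        V = .decremental) := by
    intro i
    have hbase : pathVertex v i.succ ∉ (baseList V : List (Vertex b d)) := by
      cases V with
      | incremental => simp [baseList]
      | decremental =>
        intro hx
        have := congrArg (fun x : Vertex b d => (x.1 : ℕ)) (List.mem_singleton.1 hx)
        simp [pathVertex] at this
    rw [List.mem_append, or_iff_right hbase, mem_epochs]
    constructor
    · rintro ⟨j, hj, hx⟩
      obtain ⟨_, hx, hiff⟩ := (mem_epoch e V T).1 hx
      obtain rfl : (i : ℕ) = j := by simpa [pathVertex] using hx
      exact hiff
    · exact fun hiff => ⟨i, i.2, (mem_epoch e V T).2 ⟨i.2, by simp [pathVertex], hiff⟩⟩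
  have hroot : pathVertex v 0 ∉ V.marked (baseList V ++ epochs (epoch e V T t) d) := by
    cases V with
    | incremental =>
      intro hx
      obtain ⟨i, _, hx⟩ := mem_epochs.1 (show _ ∈ epochs _ d from hx)
      obtain ⟨_, hx, _⟩ := (mem_epoch e _ T).1 hx
      simp [pathVertex] at hx
    | decremental =>
      intro hx
      refine hx (List.mem_append_left _ (List.mem_singleton.2 ?_))
      exact congrArg (Sigma.mk (0 : Fin (d + 1))) (funext fun j => j.elim0)
  have hsucc : ∀ i : Fin d, pathVertex v i.succ ∈ V.marked
      (baseList V ++ epochs (epoch e V T t) d) ↔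
      ¬ Matches e T (digits b d t) (mix (pathVertex v i.succ) (digits b d t)) i := by
    intro i
    have := hmem i
    cases V with
    | incremental => simpa [Variant.marked] using this
    | decremental =>
      simp only [iff_true] at this
      exact not_congr this
  rw [Fin.exists_fin_succ, or_iff_right hroot]
  exact exists_congr hsucc

lemma DataStructure.Solves.output_memAt {w tu tq : ℕ} {V : Variant} {D : DataStructure w b d}
    (hD : D.Solves V tu tq) (t : ℕ) (v : Leaf b d) :
    (D.query v).output (memAt e V T D t) = true ↔
      ∃ i : Fin d, ¬ Matches e T (digits b d t) (mix (pathVertex v i.succ) (digits b d t)) i := by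
  rw [memAt, ← memoryAfter_append, hD.query_correct _ v (nodup_epochs_epoch e V T t)]
  exact exists_marked_iff e V T t v

end Instance

/-! ### From a data structure to certificates -/

section Certificates

variable {w b h d tu tq : ℕ}

section Spacetime

variable [NeZero b] (e : Fin b ≃ Fin h × Bool) {V : Variant} (T : Input h b d)
  {D : DataStructure w b d}

/-- All contents of the addresses `addr 0, …, addr (α - 1)` in all versions are described by few
short pieces. -/
lemma DataStructure.Solves.exists_pieces_memAt (hD : D.Solves V tu tq) {α : ℕ} (addr idx : ℕ → ℕ)
    (hidx : ∀ p < α, idx (addr p) = p) :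
    ∃ (piece : ℕ → Fin (2 * d * b ^ (d + 1) * tu + 1))
      (desc : Fin (2 * d * b ^ (d + 1) * tu + 1) →
        Option (Fin (α * b ^ d) × Fin (α * b ^ d) × BitVec w)),
      (∀ k < α * b ^ d, ∃ lo hi : Fin (α * b ^ d), desc (piece k) = some (lo, hi,
          memAt e V T D (k % b ^ d) (addr (k / b ^ d)) ^^^
            D.memoryAfter (baseList V) (addr (k / b ^ d))) ∧ lo ≤ k ∧ k ≤ hi) ∧
      ∀ p lo hi v, desc p = some (lo, hi, v) → ∀ k, (lo : ℕ) ≤ k → k ≤ hi →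
        memAt e V T D (k % b ^ d) (addr (k / b ^ d)) ^^^
            D.memoryAfter (baseList V) (addr (k / b ^ d)) = v := by
  refine exists_pieces _ _ (fun k => memAt e V T D (k % b ^ d) (addr (k / b ^ d)) ^^^
    D.memoryAfter (baseList V) (addr (k / b ^ d))) ?_
  convert card_breaks_le (d := d) (α := α) (tu := tu) (Nat.pos_of_ne_zero (NeZero.ne b))
    (memAt e V T D) (D.memoryAfter (baseList V))
    (fun t i => D.touchedAt (epoch e V T t) (D.memoryAfter (baseList V)) d i) addr idx hidx
    (fun t a hta => D.exists_touchedAt_of_ne _ _ d a hta)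
    (fun t a hta => D.exists_touchedAt_of_ne_run _ _ t (t + 1) b
      (fun j hj => epoch_congr e V T hj) _ d a hta)
    (fun t i => (hD.card_touchedAt_le _ _ d i (nodup_epochs_epoch e V T t)).trans
      (Nat.mul_le_mul_right _ (length_epoch_le e V T t i)))

end Spacetime

lemma card_pieceDesc_le {α n q w : ℕ} (hα : α ≤ q) :
    Fintype.card (Option (Fin (α * n) × Fin (α * n) × BitVec w)) ≤ (q * n) ^ 2 * 2 ^ w + 1 := by
  rw [Fintype.card_option, Fintype.card_prod, Fintype.card_prod, Fintype.card_fin, card_bitVec,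
    ← mul_assoc, ← sq]
  gcongr

lemma card_group (b d : ℕ) : Fintype.card (Group b d) = d * b ^ (d - 1) := by
  simp [Fintype.card_sigma]

/-- A data structure for a tree of degree `b = 2h` yields many certificates. -/
theorem DataStructure.Solves.exists_bounds (hh : 0 < h) (hd : 0 < d) (e : Fin b ≃ Fin h × Bool)
    (hb : 0 < b) {V : Variant} {D : DataStructure w b d} (hD : D.Solves V tu tq) :
    ∃ u : ℕ, 2 ^ u ≤ smallSubsets (2 * d * b ^ (d + 1) * tu + 1) (b ^ d * tq) *
        ((b ^ d * (2 ^ w + 1) ^ tq * b ^ d) ^ 2 * 2 ^ w + 1) ^ (b ^ d * tq) ∧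
      ((h.factorial ^ (d * b ^ (d - 1)) : ℕ) : ℝ) ≤
        smallSubsets (2 * d * b ^ (d + 1) * tu + 1) (b ^ d * tq) *
          ((u : ℝ) / (d * b ^ (d - 1) * h : ℕ)) ^ (d * b ^ (d - 1) * h) := by
  classical
  have : NeZero b := ⟨hb.ne'⟩
  have : Nonempty (Group b d) := ⟨⟨⟨0, hd⟩, fun _ => 0⟩⟩
  set n := b ^ d with hn
  have hn0 : 0 < n := by positivity
  -- This set of addresses does not depend on `T`, so all inputs share one numbering.
  let A : Finset ℕ := Finset.univ.biUnion fun v : Leaf b d => (D.query v).reach tq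
  have hA : A.card ≤ n * (2 ^ w + 1) ^ tq := by
    have := Finset.card_biUnion_le_card_mul (Finset.univ : Finset (Leaf b d))
      (fun v => (D.query v).reach tq) _ fun v _ => (D.query v).card_reach_le tq
    simpa using this
  let addr : ℕ → ℕ := fun p => if hp : p < A.card then A.equivFin.symm ⟨p, hp⟩ else 0
  let idx : ℕ → ℕ := fun a => if ha : a ∈ A then A.equivFin ⟨a, ha⟩ else 0
  have hidx : ∀ p < A.card, idx (addr p) = p := fun p hp => by simp [idx, addr, hp]
  have haddr : ∀ a ∈ A, idx a < A.card ∧ addr (idx a) = a := fun a ha => by simp [idx, addr, ha]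
  have hpieces := fun T : Input h b d => hD.exists_pieces_memAt e T addr idx hidx
  choose piece desc hdesc hval using hpieces
  have hkey : ∀ a ∈ A, ∀ t < n, idx a * n + t < A.card * n ∧ (idx a * n + t) % n = t ∧
      addr ((idx a * n + t) / n) = a := fun a ha t ht => by
    obtain ⟨h1, h2⟩ := haddr a ha
    refine ⟨by nlinarith, by rw [mul_comm, Nat.mul_add_mod, Nat.mod_eq_of_lt ht], ?_⟩
    rw [mul_comm, Nat.mul_add_div hn0, Nat.div_eq_of_lt ht, add_zero, h2]
  let leaf : Input h b d → (Group b d → Equiv.Perm (Fin h)) → ℕ → Leaf b d :=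
    fun T τ t => walk e T τ (digits b d t) d
  let P : Input h b d → (Group b d → Equiv.Perm (Fin h)) →
      Finset (Fin (2 * d * b ^ (d + 1) * tu + 1)) := fun T τ =>
    (Finset.range n).biUnion fun t =>
      ((D.query (leaf T τ t)).probed (memAt e V T D t)).image fun a => piece T (idx a * n + t)
  have hqt : ∀ T t v, (D.query v).time (memAt e V T D t) ≤ tq := fun T t v => by
    rw [memAt, ← memoryAfter_append]
    exact hD.query_time _ v (nodup_epochs_epoch e V T t)
  have hP : ∀ T τ, (P T τ).card ≤ n * tq := fun T τ => by
    have := Finset.card_biUnion_le_card_mul (Finset.range n) (fun t =>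
      ((D.query (leaf T τ t)).probed (memAt e V T D t)).image fun a => piece T (idx a * n + t)) tq
      fun t _ => Finset.card_image_le.trans ((Program.card_probed_le _ _).trans (hqt _ _ _))
    rwa [Finset.card_range] at this
  have hagree : ∀ T₀ T τ, (∀ p ∈ P T₀ τ, desc T p = desc T₀ p) →
      ∀ i r, T (i, r, τ i r) = T₀ (i, r, τ i r) := by
    intro T₀ T τ hp
    have hout : ∀ t < n, ∀ i : Fin d, Matches e T (digits b d t)
        (mix (pathVertex (leaf T₀ τ t) i.succ) (digits b d t)) i := by
      intro t ht
      have hsame : (D.query (leaf T₀ τ t)).output (memAt e V T D t) =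
          (D.query (leaf T₀ τ t)).output (memAt e V T₀ D t) := by
        refine Program.output_congr _ fun a ha => ?_
        have haA : a ∈ A := Finset.mem_biUnion.2 ⟨leaf T₀ τ t, Finset.mem_univ _,
          Program.probed_subset_reach _ (hqt _ _ _) ha⟩
        obtain ⟨hk, hmod, hdiv⟩ := hkey a haA t ht
        obtain ⟨lo, hi, hlohi, hlo, hhi⟩ := hdesc T₀ _ hk
        have hmem : piece T₀ (idx a * n + t) ∈ P T₀ τ := Finset.mem_biUnion.2
          ⟨t, Finset.mem_range.2 ht, Finset.mem_image.2 ⟨a, ha, rfl⟩⟩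
        -- A description contains its own interval, so equal descriptions fix the cell under `T` as
        -- well, although `T` may number its pieces differently.
        have := hval T _ lo hi _ ((hp _ hmem).trans hlohi) _ hlo hhi
        rw [← hn, hmod, hdiv] at this
        exact BitVec.xor_left_inj _ |>.1 this
      have hfalse : (D.query (leaf T₀ τ t)).output (memAt e V T₀ D t) ≠ true := by
        rw [Ne, hD.output_memAt e T₀]
        push Not
        intro i
        rw [mix_pathVertex_walk, matches_walk_iff]
      rw [← hsame, Ne, hD.output_memAt e T] at hfalse
      push Not at hfalse
      exact hfalse
    -- Since i steps of the walk are surjective, some version arrives at this group with label r.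
    rintro ⟨i, g⟩ r
    obtain ⟨s, hs⟩ : ∃ s : Fin b, (e s).1 = r := ⟨e.symm (r, false), by simp⟩
    let y : Fin d → Fin b := fun j => if hj : j = i then s else g ⟨j, hj⟩
    have hy : group i y = ⟨i, g⟩ := by
      simp only [group, Sigma.mk.injEq, heq_eq_eq, true_and]
      funext j
      simp [y, j.2]
    obtain ⟨u, hu⟩ := walk_surjective e T₀ τ i y
    obtain ⟨t, ht, rfl⟩ := exists_digits_eq u
    have hui : (e (digits b d t i)).1 = r := by
      rw [← walk_of_le e T₀ τ (digits b d t) le_rfl]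
      simp only at hu
      rw [hu]
      simpa [y] using hs
    have := hout t ht i
    simp only at hu
    rw [mix_pathVertex_walk, matches_walk_iff, hu, hy, hui] at this
    exact this
  obtain ⟨u, hu1, hu2⟩ := exists_card_bounds hh P hP desc hagree
  rw [card_group] at hu2
  refine ⟨u, hu1.trans ?_, hu2⟩
  gcongr
  exact card_pieceDesc_le hA

end Certificates

/-! ### Choice of parameters -/

/-- A data structure with fast updates and queries forces the degree of the tree to be small compared
with the number `β` of bits which describe a piece. -/
theorem DataStructure.Solves.degree_le {w h d tu tq β : ℕ} (hh : 0 < h) (hd : 0 < d) {V : Variant}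
    {D : DataStructure w (h * 2) d} (hD : D.Solves V tu tq)
    (hX : (4 * (h * 2) * tu + 1) ^ tq ≤ 2 ^ d) (htq : tq ≤ d)
    (hβ : ((h * 2) ^ d * (2 ^ w + 1) ^ tq * (h * 2) ^ d) ^ 2 * 2 ^ w + 1 ≤ 2 ^ β) :
    h ≤ 36 * (4 + 2 * β) := by
  have hb : 0 < h * 2 := by omega
  have e : Fin (h * 2) ≃ Fin h × Bool :=
    finProdFinEquiv.symm.trans ((Equiv.refl _).prodCongr finTwoEquiv)
  obtain ⟨u, hu1, hu2⟩ := hD.exists_bounds hh hd e hb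
  set I := d * (h * 2) ^ (d - 1) with hI
  have hI0 : 0 < I := by positivity
  set N := I * h with hN
  have hN0 : 0 < N := by positivity
  set S := 2 * d * (h * 2) ^ (d + 1) * tu + 1 with hS
  set q := (h * 2) ^ d * tq with hq
  -- This weight gives S ≤ N·X, so exp(S/X) ≤ 3^N, while `hX` turns X^q into at most 4^N.
  set X := 4 * (h * 2) * tu + 1 with hXdef
  set A := smallSubsets S q with hA
  have hdn : (h * 2) ^ d * d = 2 * N := by
    obtain ⟨d, rfl⟩ := Nat.exists_eq_succ_of_ne_zero hd.ne'
    simp only [hN, hI, Nat.succ_eq_add_one, Nat.add_sub_cancel]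
    ring
  have hSN : S ≤ N * X := by
    have : S = 4 * N * (h * 2) * tu + 1 := by
      rw [hS, pow_succ]
      calc _ = 2 * ((h * 2) ^ d * d) * (h * 2) * tu + 1 := by ring
        _ = _ := by rw [hdn]; ring
    rw [this, hXdef]
    nlinarith
  have hqN : q ≤ 2 * N := by
    rw [← hdn]; exact Nat.mul_le_mul_left _ htq
  have hXq : X ^ q ≤ 4 ^ N := by
    calc X ^ q = (X ^ tq) ^ (h * 2) ^ d := by rw [← pow_mul, mul_comm tq]
      _ ≤ (2 ^ d) ^ (h * 2) ^ d := Nat.pow_le_pow_left hX _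
      _ = 4 ^ N := by rw [← pow_mul, mul_comm d, hdn, pow_mul]; norm_num
  have he3 : Real.exp 1 ≤ 3 := Real.exp_one_lt_d9.le.trans (by norm_num)
  have hexp : ∀ k : ℕ, Real.exp k ≤ 3 ^ k := fun k => by
    rw [← mul_one (k : ℝ), Real.exp_nat_mul]
    exact pow_le_pow_left₀ (Real.exp_pos _).le he3 _
  have hA12 : (A : ℝ) ≤ 12 ^ N := by
    have hX1 : 1 ≤ X := by omega
    have hX0 : (0 : ℝ) < X := by exact_mod_cast hX1
    calc (A : ℝ) ≤ X ^ q * Real.exp (S / X) := smallSubsets_le S q X hX1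
      _ ≤ 4 ^ N * Real.exp N := by
        gcongr
        · exact_mod_cast hXq
        · rw [div_le_iff₀ hX0]; exact_mod_cast hSN
      _ ≤ 4 ^ N * 3 ^ N := by gcongr; exact hexp N
      _ = 12 ^ N := by rw [← mul_pow]; norm_num
  have huN : u ≤ (4 + 2 * β) * N := by
    refine (Nat.pow_le_pow_iff_right (a := 2) (by norm_num)).1 (hu1.trans ?_)
    calc A * _ ≤ 12 ^ N * (2 ^ β) ^ q := by
          gcongr
          exact_mod_cast hA12
      _ ≤ 16 ^ N * (2 ^ β) ^ (2 * N) := by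
          gcongr
          · norm_num
          · exact Nat.one_le_two_pow
      _ = 2 ^ ((4 + 2 * β) * N) := by
          rw [show 16 = 2 ^ 4 by norm_num, ← pow_mul, ← pow_mul, ← pow_add]
          congr 1; ring
  have hfact : (h : ℝ) ^ h ≤ 3 ^ h * h.factorial := by
    have h1 := Real.pow_div_factorial_le_exp (x := (h : ℝ)) (by positivity) h
    rw [div_le_iff₀ (by positivity)] at h1
    exact h1.trans (by gcongr; exact hexp h)
  have hfin : (h : ℝ) ^ N ≤ (36 * (4 + 2 * β) : ℝ) ^ N := by
    calc (h : ℝ) ^ N = ((h : ℝ) ^ h) ^ I := by rw [← pow_mul, hN, mul_comm]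
      _ ≤ (3 ^ h * h.factorial) ^ I := by gcongr
      _ = 3 ^ N * ((h.factorial ^ I : ℕ) : ℝ) := by
        rw [mul_pow, ← pow_mul, hN, mul_comm h]; push_cast; rfl
      _ ≤ 3 ^ N * (12 ^ N * ((4 + 2 * β : ℕ) : ℝ) ^ N) := by
        gcongr
        refine hu2.trans ?_
        gcongr
        rw [div_le_iff₀ (by exact_mod_cast hN0)]
        exact_mod_cast huN
      _ = _ := by rw [← mul_pow, ← mul_pow]; push_cast; ring_nf
  have := (pow_le_pow_iff_left₀ (by positivity) (by positivity) hN0.ne').1 hfin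
  exact_mod_cast this

lemma card_vertex_le {b d : ℕ} (hb : 2 ≤ b) : Fintype.card (Vertex b d) ≤ b ^ (d + 1) := by
  have h1 : Fintype.card (Vertex b d) = ∑ i ∈ Finset.range (d + 1), b ^ i := by
    rw [Fintype.card_sigma, ← Fin.sum_univ_eq_sum_range]
    simp
  rw [h1]
  exact (Nat.geomSum_lt hb fun k hk => Finset.mem_range.1 hk).le

/-- The lower bound in terms of the integral part `l` of `log₂ m`. -/
theorem exists_tree_lower_bound (c : ℕ) {m l : ℕ} (hl : l = Nat.log 2 m) (hm : m ≠ 0)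
    (hl1 : 1152 * 2 ^ c < l) (hl2 : 2 * (c + 2) * (Nat.log 2 l + 1) + 2 ≤ l) (V : Variant) :
    ∃ b d : ℕ, 2 ≤ b ∧ Fintype.card (Vertex b d) ≤ m ∧
      ∀ w tu tq : ℕ, w ≤ (2 * l) ^ c → tu ≤ (2 * l) ^ c →
        ∀ D : DataStructure w b d, D.Solves V tu tq →
          l ≤ 6 * (c + 2) * (6 + 3 * c) * (Nat.log 2 l + 1) ^ 2 * tq := by
  set r := Nat.log 2 l + 1 with hr
  have hl0 : 1 ≤ l := by omega
  -- One factor l more than the bound of `degree_le`: with β = 14 (2l)^c l, it is at most 36 · (4 +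
  -- 28) = 1152 times (2l)^c l.
  set h := l ^ (c + 2) with hh
  have hh0 : 0 < h := by positivity
  have hb2 : 2 ≤ h * 2 := by omega
  set D := Nat.log (h * 2) m - 1 with hDdef
  have hlr : l ≤ 2 ^ r := (Nat.lt_pow_succ_log_self (by norm_num) l).le
  have hbr : h * 2 ≤ 2 ^ (r * (c + 2) + 1) := by
    rw [pow_succ, pow_mul]
    exact Nat.mul_le_mul_right _ (Nat.pow_le_pow_left hlr _)
  have h2l : 2 ^ l ≤ m := hl ▸ Nat.pow_log_le_self 2 hm
  have hml : m < 2 ^ (l + 1) := hl ▸ Nat.lt_pow_succ_log_self (by norm_num) m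
  have hmb : m < (h * 2) ^ (Nat.log (h * 2) m + 1) := Nat.lt_pow_succ_log_self (by omega) m
  have hlog : ∀ k, m < (h * 2) ^ k → l < (r * (c + 2) + 1) * k := fun k hk => by
    refine (Nat.pow_lt_pow_iff_right (a := 2) (by norm_num)).1 (h2l.trans_lt (hk.trans_le ?_))
    rw [pow_mul]
    exact Nat.pow_le_pow_left hbr k
  -- This makes D positive and gives log + 1 = D + 2 ≤ 3D below.
  have hlog2 : 2 ≤ Nat.log (h * 2) m := by
    by_contra hlt
    have := hlog 2 (hmb.trans_le (Nat.pow_le_pow_right (by omega) (by omega)))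
    nlinarith
  have hD0 : 0 < D := by omega
  have hlD : l ≤ 6 * (c + 2) * r * D := by
    have := hlog (3 * D) (hmb.trans_le (Nat.pow_le_pow_right (by omega) (by omega)))
    have hr1 : 1 ≤ r * (c + 2) := Nat.one_le_iff_ne_zero.2 (by positivity)
    calc l ≤ (r * (c + 2) + 1) * (3 * D) := this.le
      _ ≤ (r * (c + 2) + r * (c + 2)) * (3 * D) := by gcongr
      _ = _ := by ring
  have hbD : (h * 2) ^ (D + 1) ≤ m := by
    rw [hDdef, Nat.sub_add_cancel (by omega)]
    exact Nat.pow_log_le_self _ hm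
  have hDl : D ≤ l := by
    refine Nat.le_of_lt_succ ((Nat.pow_lt_pow_iff_right (a := 2) (by norm_num)).1
      (lt_of_le_of_lt ?_ hml))
    exact (Nat.pow_le_pow_left hb2 D).trans
      ((Nat.pow_le_pow_right (by omega) D.le_succ).trans hbD)
  refine ⟨h * 2, D, hb2, (card_vertex_le hb2).trans hbD, fun w tu tq hw htu Ds hDs => ?_⟩
  have hmain : D ≤ (6 + 3 * c) * r * tq := by
    by_contra! hlt
    have hr1 : 1 ≤ r := by omega
    have htq : tq ≤ D := by
      refine le_trans ?_ hlt.le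
      exact Nat.le_mul_of_pos_left _ (by positivity)
    have hW1 : 1 ≤ (2 * l) ^ c := Nat.one_le_pow _ _ (by omega)
    have hX : (4 * (h * 2) * tu + 1) ^ tq ≤ 2 ^ D := by
      calc (4 * (h * 2) * tu + 1) ^ tq ≤ (2 ^ ((6 + 3 * c) * r)) ^ tq := by
            gcongr
            calc 4 * (h * 2) * tu + 1 ≤ 4 * (h * 2) * (2 * l) ^ c + 1 := by gcongr
              _ ≤ 2 ^ 3 * (h * 2) * (2 * l) ^ c := by nlinarith [Nat.mul_le_mul hb2 hW1]
              _ ≤ 2 ^ 3 * 2 ^ (r * (c + 2) + 1) * (2 * 2 ^ r) ^ c := by gcongr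
              _ = 2 ^ (4 + r * (c + 2) + (c + r * c)) := by
                rw [mul_pow, ← pow_mul, ← pow_add, ← pow_add, ← pow_add]; congr 1; ring
              _ ≤ 2 ^ ((6 + 3 * c) * r) := by
                apply Nat.pow_le_pow_right (by norm_num)
                nlinarith
        _ = 2 ^ ((6 + 3 * c) * r * tq) := by rw [← pow_mul]
        _ ≤ 2 ^ D := Nat.pow_le_pow_right (by norm_num) hlt.le
    have hn : (h * 2) ^ D ≤ 2 ^ (l + 1) :=
      ((Nat.pow_le_pow_right (by omega) D.le_succ).trans hbD).trans hml.le
    have hβ : ((h * 2) ^ D * (2 ^ w + 1) ^ tq * (h * 2) ^ D) ^ 2 * 2 ^ w + 1 ≤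
        2 ^ (14 * (2 * l) ^ c * l) := by
      have h2w : 2 ^ w + 1 ≤ 2 ^ (w + 1) := by
        rw [pow_succ]; have := Nat.one_le_two_pow (n := w); omega
      calc ((h * 2) ^ D * (2 ^ w + 1) ^ tq * (h * 2) ^ D) ^ 2 * 2 ^ w + 1
          ≤ (2 ^ (l + 1) * (2 ^ (w + 1)) ^ l * 2 ^ (l + 1)) ^ 2 * 2 ^ w + 1 := by
            gcongr
            · exact Nat.one_le_two_pow
            · exact htq.trans hDl
        _ = 2 ^ (4 * (l + 1) + 2 * (w + 1) * l + w) + 1 := by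
            rw [← pow_mul, ← pow_add, ← pow_add, ← pow_mul, ← pow_add]; congr 2; ring
        _ ≤ 2 ^ (4 * (l + 1) + 2 * (w + 1) * l + w + 1) := by
            rw [pow_succ 2 (4 * (l + 1) + 2 * (w + 1) * l + w)]
            have := Nat.one_le_two_pow (n := 4 * (l + 1) + 2 * (w + 1) * l + w)
            omega
        _ ≤ 2 ^ (14 * (2 * l) ^ c * l) := by
            apply Nat.pow_le_pow_right (by norm_num)
            have h1 : w * l ≤ (2 * l) ^ c * l := Nat.mul_le_mul_right _ hw
            have h2 : l ≤ (2 * l) ^ c * l := Nat.le_mul_of_pos_left _ hW1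
            have h3 : (2 * l) ^ c ≤ (2 * l) ^ c * l := Nat.le_mul_of_pos_right _ hl0
            nlinarith
    have hdeg := hDs.degree_le hh0 hD0 hX htq hβ
    have h1 : 1 ≤ (2 * l) ^ c * l := Nat.mul_pos hW1 hl0
    have h2 : h ≤ 1152 * 2 ^ c * l ^ (c + 1) := by
      have hring : 1152 * 2 ^ c * l ^ (c + 1) = 1152 * ((2 * l) ^ c * l) := by
        rw [mul_pow]; ring
      rw [hring]
      have : 14 * (2 * l) ^ c * l = 14 * ((2 * l) ^ c * l) := mul_assoc _ _ _
      omega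
    have h3 : 1152 * 2 ^ c * l ^ (c + 1) < h := by
      rw [hh, show c + 2 = (c + 1) + 1 by ring, pow_succ l (c + 1), mul_comm (l ^ (c + 1))]
      exact Nat.mul_lt_mul_of_pos_right hl1 (by positivity)
    exact absurd (h2.trans_lt h3) (lt_irrefl _)
  calc l ≤ 6 * (c + 2) * r * D := hlD
    _ ≤ 6 * (c + 2) * r * ((6 + 3 * c) * r * tq) := by gcongr
    _ = _ := by ring

/-- Logarithms grow slowly. -/
lemma exists_forall_mul_log_le (k : ℕ) : ∃ l₀, ∀ l ≥ l₀, k * (Nat.log 2 l + 1) + 2 ≤ l := by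
  have h1 : Filter.Tendsto (fun x : ℝ => Real.log x / x) Filter.atTop (nhds 0) := by
    simpa using (Real.tendsto_pow_log_div_mul_add_atTop 1 0 1 one_ne_zero)
  have h2 := (h1.eventually_lt_const
    (show (0 : ℝ) < Real.log 2 / (2 * (k + 1)) by positivity)).and
    (Filter.eventually_ge_atTop ((2 * (k + 2) : ℝ)))
  obtain ⟨l₀, hl₀⟩ := Filter.eventually_atTop.1
    (tendsto_natCast_atTop_atTop.eventually h2)
  refine ⟨max l₀ 1, fun l hl => ?_⟩
  obtain ⟨h3, h4⟩ := hl₀ l (le_of_max_le_left hl)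
  have hl0 : (0 : ℝ) < l := by exact_mod_cast (le_of_max_le_right hl)
  have h5 : (Nat.log 2 l : ℝ) ≤ Real.logb 2 l := by
    exact_mod_cast Real.natLog_le_logb l 2
  rw [div_lt_iff₀ hl0, div_mul_eq_mul_div, lt_div_iff₀ (by positivity)] at h3
  have h6 : Real.logb 2 l * (2 * (k + 1)) ≤ l := by
    rw [Real.logb, div_mul_eq_mul_div, div_le_iff₀ (Real.log_pos (by norm_num))]
    linarith
  have h7 : (k * (Nat.log 2 l + 1) + 2 : ℝ) ≤ l := by
    have hk : (0 : ℝ) ≤ k := by positivity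
    have hlog : (0 : ℝ) ≤ Nat.log 2 l := by positivity
    nlinarith [mul_le_mul_of_nonneg_left h5 hk]
  exact_mod_cast h7

end CellProbe

theorem mainTheorem6 (c : ℕ) :
    ∃ C : ℝ, 0 < C ∧ ∃ m₀ : ℕ, ∀ (V : CellProbe.Variant) (m : ℕ), m₀ ≤ m →
      ∃ b d : ℕ, 2 ≤ b ∧ Fintype.card (CellProbe.Vertex b d) ≤ m ∧
        ∀ w tu tq : ℕ, (w : ℝ) ≤ Real.logb 2 m ^ c → (tu : ℝ) ≤ Real.logb 2 m ^ c →
          ∀ D : CellProbe.DataStructure w b d, D.Solves V tu tq →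
            C * (Real.logb 2 m / Real.logb 2 (Real.logb 2 m) ^ 2) ≤ (tq : ℝ) := by
  obtain ⟨l₀, hl₀⟩ := CellProbe.exists_forall_mul_log_le (2 * (c + 2))
  -- The 8 is 2 · 2²: lg m ≤ 2l, and `Nat.log 2 l + 1` ≤ 2 lg lg m enters squared.
  refine ⟨1 / (8 * (6 * (c + 2) * (6 + 3 * c))), by positivity,
    2 ^ (max l₀ (1152 * 2 ^ c + 1)), fun V m hm => ?_⟩
  have hm0 : m ≠ 0 := by
    have : 0 < 2 ^ (max l₀ (1152 * 2 ^ c + 1)) := by positivity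
    omega
  have hmax : max l₀ (1152 * 2 ^ c + 1) ≤ Nat.log 2 m :=
    (Nat.le_log_iff_pow_le (by norm_num) hm0).2 hm
  set l := Nat.log 2 m with hl
  have hl1 : 1152 * 2 ^ c < l := (le_max_right _ _).trans hmax
  obtain ⟨b, d, hb, hcard, hD⟩ := CellProbe.exists_tree_lower_bound c hl hm0 hl1
    (hl₀ l ((le_max_left _ _).trans hmax)) V
  refine ⟨b, d, hb, hcard, fun w tu tq hw htu D hsolves => ?_⟩
  have h2 : 2 ≤ l := by
    have := Nat.one_le_two_pow (n := c)
    omega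
  have hlL : (l : ℝ) ≤ Real.logb 2 m := by exact_mod_cast Real.natLog_le_logb m 2
  have hL0 : 0 ≤ Real.logb 2 m := le_trans (by positivity) hlL
  have hLl : Real.logb 2 m ≤ 2 * l := by
    have h1 : Real.logb 2 m ≤ l + 1 := by
      rw [Real.logb_le_iff_le_rpow (by norm_num) (by positivity)]
      have h3 : m ≤ 2 ^ (l + 1) := (Nat.lt_pow_succ_log_self (by norm_num) m).le
      calc (m : ℝ) ≤ ((2 ^ (l + 1) : ℕ) : ℝ) := by exact_mod_cast h3
        _ = 2 ^ ((l : ℝ) + 1) := by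
          rw [← Nat.cast_succ, Real.rpow_natCast]; push_cast; rfl
    have : (2 : ℝ) ≤ l := by exact_mod_cast h2
    linarith
  have hpow : Real.logb 2 m ^ c ≤ (((2 * l) ^ c : ℕ) : ℝ) := by
    push_cast
    exact pow_le_pow_left₀ hL0 hLl c
  have key := hD w tu tq (by exact_mod_cast hw.trans hpow) (by exact_mod_cast htu.trans hpow) D
    hsolves
  have hl2 : (2 : ℝ) ≤ l := by exact_mod_cast h2
  have h1 : 1 ≤ Real.logb 2 (Real.logb 2 m) := by
    rw [Real.le_logb_iff_rpow_le (by norm_num) (by linarith), Real.rpow_one]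
    linarith
  have hr : ((Nat.log 2 l + 1 : ℕ) : ℝ) ≤ 2 * Real.logb 2 (Real.logb 2 m) := by
    have h3 : (Nat.log 2 l : ℝ) ≤ Real.logb 2 l := by exact_mod_cast Real.natLog_le_logb l 2
    have h4 : Real.logb 2 l ≤ Real.logb 2 (Real.logb 2 m) :=
      Real.logb_le_logb_of_le (by norm_num) (by linarith) hlL
    push_cast
    linarith
  have key' : (l : ℝ) ≤ 6 * (c + 2) * (6 + 3 * c) * ((Nat.log 2 l + 1 : ℕ) : ℝ) ^ 2 * tq := by
    exact_mod_cast key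
  rw [one_div_mul_eq_div, div_le_iff₀ (by positivity), div_le_iff₀ (by positivity)]
  calc Real.logb 2 m ≤ 2 * l := hLl
    _ ≤ 2 * (6 * (c + 2) * (6 + 3 * c) * ((Nat.log 2 l + 1 : ℕ) : ℝ) ^ 2 * tq) := by gcongr
    _ ≤ 2 * (6 * (c + 2) * (6 + 3 * c) * (2 * Real.logb 2 (Real.logb 2 m)) ^ 2 * tq) := by
      gcongr
    _ = _ := by ring
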